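/- A finite set $s\subseteq\mathbb{N}$ is exactly $\omega$-large if it is non-empty and $|s|=1+\min s$. For $X\subseteq\mathbb{N}$ let $[X]^{!\omega}$ be the family of exactly $\omega$-large subsets of $X$ (so $[\mathbb{N}]^{!\omega}$ is the Schreier barrier). Given $f:[\mathbb{N}]^{!\omega}\to\mathbb{N}$, a set $H\subseteq\mathbb{N}$ is $f$-thin for the color $c\in\mathbb{N}$ if $c\notin f([H]^{!\omega})$, and $f$-thin if it is $f$-thin for some color. For $X\subseteq\mathbb{N}$ let $X'=\{e:\Phi_e^X(e)\downarrow\}$ be the Turing jump, $X^{(0)}=X$, $X^{(n+1)}=(X^{(n)})'$, and $X^{(\omega)}=\bigoplus_n X^{(n)}=\{\langle n,m\rangle : m\in X^{(n)}\}$. **Theorem.** There exists a computable coloring $f:[\mathbb{N}]^{!\omega}\to\mathbb{N}$ such that every infinite $f$-thin set $H$ computes $\emptyset^{(\omega)}$. Moreover, this computation is uniform in $H$ and an avoided color: there is a single Turing functional $\Phi$ such that for every infinite set $H\subseteq\mathbb{N}$ and every color $c\in\mathbb{N}$ for which $H$ is $f$-thin, the function $n\mapsto\Phi^H(c,n)$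 is total and is the characteristic function of $\emptyset^{(\omega)}$. -/

import Mathlib

/-! ### Oracle computability: indices, Turing functionals, jumps -/

/-- Programs for Turing functionals: the usual generators of the partial recursive functions,
together with an instruction `oracle` that queries the oracle. -/
inductive OracleCode : Type
  | zero : OracleCode
  | succ : OracleCode
  | left : OracleCode
  | right : OracleCode
  | oracle : OracleCode
  | pair : OracleCode → OracleCode → OracleCode
  | comp : OracleCode → OracleCode → OracleCode
  | prec : OracleCode → OracleCode → OracleCode
  | rfind : OracleCode → OracleCode

namespace OracleCode

/-- The partial function `Φ_c^g` computed by the program `c` with oracle `g`. The clauses are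
those of Mathlib's `Nat.RecursiveIn {g}`. -/
def eval (g : ℕ → ℕ) : OracleCode → ℕ →. ℕ
  | zero => fun _ => Part.some 0
  | succ => fun n => Part.some (n + 1)
  | left => fun n => Part.some n.unpair.1
  | right => fun n => Part.some n.unpair.2
  | oracle => fun n => Part.some (g n)
  | pair cf ch => fun n => Nat.pair <$> eval g cf n <*> eval g ch n
  | comp cf ch => fun n => eval g ch n >>= eval g cf
  | prec cf ch => fun p =>
      let (a, n) := Nat.unpair p
      n.rec (eval g cf a) fun y IH => do
        let i ← IH
        eval g ch (Nat.pair a (Nat.pair y i))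
  | rfind cf => fun a =>
      Nat.rfind fun n => (fun m => decide (m = 0)) <$> eval g cf (Nat.pair a n)

/-- The Gödel number of a program. -/
def toNat : OracleCode → ℕ
  | zero => 0
  | succ => 1
  | left => 2
  | right => 3
  | oracle => 4
  | pair cf ch => 4 * Nat.pair (toNat cf) (toNat ch) + 5
  | comp cf ch => 4 * Nat.pair (toNat cf) (toNat ch) + 6
  | prec cf ch => 4 * Nat.pair (toNat cf) (toNat ch) + 7
  | rfind cf => 4 * toNat cf + 8

/-- The program with a given Gödel number: the inverse of `toNat`. -/
def ofNat : ℕ → OracleCode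
  | 0 => zero
  | 1 => succ
  | 2 => left
  | 3 => right
  | 4 => oracle
  | n + 5 =>
    have h : n / 4 < n + 5 := by omega
    have h₁ : (n / 4).unpair.1 < n + 5 := (Nat.unpair_left_le _).trans_lt h
    have h₂ : (n / 4).unpair.2 < n + 5 := (Nat.unpair_right_le _).trans_lt h
    match n % 4 with
    | 0 => pair (ofNat (n / 4).unpair.1) (ofNat (n / 4).unpair.2)
    | 1 => comp (ofNat (n / 4).unpair.1) (ofNat (n / 4).unpair.2)
    | 2 => prec (ofNat (n / 4).unpair.1) (ofNat (n / 4).unpair.2)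
    | _ => rfind (ofNat (n / 4))

theorem ofNat_toNat (c : OracleCode) : ofNat (toNat c) = c := by
  induction c with
  | zero | succ | left | right | oracle => simp [toNat, ofNat]
  | pair a b iha ihb =>
    have h1 : 4 * Nat.pair (toNat a) (toNat b) % 4 = 0 := by omega
    have h2 : 4 * Nat.pair (toNat a) (toNat b) / 4 = Nat.pair (toNat a) (toNat b) := by omega
    simp [toNat, ofNat, h1, h2, iha, ihb]
  | comp a b iha ihb =>
    have h1 : (4 * Nat.pair (toNat a) (toNat b) + 1) % 4 = 1 := by omega
    have h2 : (4 * Nat.pair (toNat a) (toNat b) + 1) / 4 = Nat.pair (toNat a) (toNat b) := by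
      omega
    rw [toNat, show 4 * Nat.pair (toNat a) (toNat b) + 6
      = (4 * Nat.pair (toNat a) (toNat b) + 1) + 5 from rfl, ofNat]
    simp [h1, h2, iha, ihb]
  | prec a b iha ihb =>
    have h1 : (4 * Nat.pair (toNat a) (toNat b) + 2) % 4 = 2 := by omega
    have h2 : (4 * Nat.pair (toNat a) (toNat b) + 2) / 4 = Nat.pair (toNat a) (toNat b) := by
      omega
    rw [toNat, show 4 * Nat.pair (toNat a) (toNat b) + 7
      = (4 * Nat.pair (toNat a) (toNat b) + 2) + 5 from rfl, ofNat]
    simp [h1, h2, iha, ihb]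
  | rfind a iha =>
    have h1 : (4 * toNat a + 3) % 4 = 3 := by omega
    have h2 : (4 * toNat a + 3) / 4 = toNat a := by omega
    rw [toNat, show 4 * toNat a + 8 = (4 * toNat a + 3) + 5 from rfl, ofNat]
    simp [h1, h2, iha]

theorem toNat_ofNat (n : ℕ) : toNat (ofNat n) = n := by
  induction n using Nat.strong_induction_on with
  | _ n ih =>
  match n with
  | 0 | 1 | 2 | 3 | 4 => simp [toNat, ofNat]
  | n + 5 =>
    have h : n / 4 < n + 5 := by omega
    have h₁ := ih _ ((Nat.unpair_left_le (n / 4)).trans_lt h)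
    have h₂ := ih _ ((Nat.unpair_right_le (n / 4)).trans_lt h)
    have h₃ := ih _ h
    rw [ofNat]
    split <;> simp_all [toNat] <;> omega

/-- The functions computed by programs with oracle `g` are exactly those Turing reducible
to `g`. -/
theorem turingReducible_iff_exists_eval (g : ℕ → ℕ) (f : ℕ →. ℕ) :
    TuringReducible f (fun n => Part.some (g n)) ↔ ∃ c : OracleCode, eval g c = f := by
  change RecursiveIn _ f ↔ _
  rw [RecursiveIn.iff_nat]
  constructor
  · intro h
    induction h with
    | zero => exact ⟨zero, rfl⟩
    | succ => exact ⟨succ, rfl⟩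
    | left => exact ⟨left, rfl⟩
    | right => exact ⟨right, rfl⟩
    | oracle k hk => exact ⟨oracle, (Set.mem_singleton_iff.1 hk).symm⟩
    | pair _ _ iha ihb =>
      obtain ⟨a, rfl⟩ := iha
      obtain ⟨b, rfl⟩ := ihb
      exact ⟨pair a b, rfl⟩
    | comp _ _ iha ihb =>
      obtain ⟨a, rfl⟩ := iha
      obtain ⟨b, rfl⟩ := ihb
      exact ⟨comp a b, rfl⟩
    | prec _ _ iha ihb =>
      obtain ⟨a, rfl⟩ := iha
      obtain ⟨b, rfl⟩ := ihb
      exact ⟨prec a b, rfl⟩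
    | rfind _ iha =>
      obtain ⟨a, rfl⟩ := iha
      exact ⟨rfind a, rfl⟩
  · rintro ⟨c, rfl⟩
    induction c with
    | zero => exact .zero
    | succ => exact .succ
    | left => exact .left
    | right => exact .right
    | oracle => exact .oracle _ rfl
    | pair a b iha ihb => exact .pair iha ihb
    | comp a b iha ihb => exact .comp iha ihb
    | prec a b iha ihb => exact .prec iha ihb
    | rfind a iha => exact .rfind iha

end OracleCode

/-- The characteristic function of a set of natural numbers. -/
noncomputable def charFn (A : Set ℕ) : ℕ → ℕ := A.indicator fun _ => 1

/-- `A` is computable from `B` (`A ≤_T B`), for sets of natural numbers. -/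
def SetTuringReducible (A B : Set ℕ) : Prop :=
  TuringReducible (fun n => Part.some (charFn A n)) (fun n => Part.some (charFn B n))

/-- The Turing jump `X' = {e | Φ_e^X(e) halts}`. -/
def turingJump (X : Set ℕ) : Set ℕ :=
  {e | (OracleCode.eval (charFn X) (OracleCode.ofNat e) e).Dom}

/-- The finite iterates `X^(n)` of the Turing jump. -/
def iteratedJump (n : ℕ) (X : Set ℕ) : Set ℕ := turingJump^[n] X

/-- The `ω`-jump `X^(ω) = ⨁ₙ X^(n) = {⟨n, m⟩ | m ∈ X^(n)}`. -/
def omegaJump (X : Set ℕ) : Set ℕ :=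
  {p | p.unpair.2 ∈ iteratedJump p.unpair.1 X}

/-! ### Exactly `ω`-large sets and thin sets -/

/-- A finite set `s` of natural numbers is exactly `ω`-large if `|s| = 1 + min s`. -/
def ExactlyOmegaLarge (s : Finset ℕ) : Prop :=
  ∃ h : s.Nonempty, s.card = 1 + s.min' h

/-- The Schreier barrier `[ℕ]^{!ω}`: the exactly `ω`-large sets. -/
abbrev SchreierBarrier : Type := {s : Finset ℕ // ExactlyOmegaLarge s}

/-- `f : [ℕ]^{!ω} → ℕ` is computable: some computable function computes `f s` from the
increasing enumeration of `s`. -/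
def ComputableColoring (f : SchreierBarrier → ℕ) : Prop :=
  ∃ F : List ℕ → ℕ, Computable F ∧ ∀ s : SchreierBarrier, F (s.1.sort (· ≤ ·)) = f s

/-- `H` is `f`-thin for the color `c`: `c ∉ f([H]^{!ω})`. -/
def ThinForColor (f : SchreierBarrier → ℕ) (H : Set ℕ) (c : ℕ) : Prop :=
  c ∉ f '' {s | (s.1 : Set ℕ) ⊆ H}

/-- `H` is `f`-thin: it is `f`-thin for some color. -/
def Thin (f : SchreierBarrier → ℕ) (H : Set ℕ) : Prop :=
  ∃ c : ℕ, ThinForColor f H c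

/-!
The set `∅^(j+1)` consists of the `e` for which some bound `k` witnesses that the `e`-th program
with oracle `∅^(j)` halts on `e` (`mem_iteratedJump_succ`). Call `y` *settled* for `x` at level
`l` (`Settled`) if for each of the first `l` jumps every number `e < x` in that jump has a witness
`k < y`. If each term of `z₀ ≤ z₁ ≤ … ≤ z_j` is settled for the preceding one, then below `z₀` the
set `∅^(j)` can be computed from `z₁, …, z_j` by replacing each unbounded search by a bounded one
(`approxJump`, `mem_approxJump_iff`). An infinite set contains, for every `x`, numbers settled
for `x` at any given level, so it suffices to color in such a way that thin sets have few
unsettled gaps.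

The color of `x₀ < x₁ < … < x_m`, `m = x₀`, is the number of unsettled gaps `(x_i, x_{i+1})` at
level `m / 2` in the first half of the sequence, where being settled is judged with the
approximation given by the last `m / 2` entries. This is computable. Suppose that `H` is infinite
and avoids the color `c`, and that `y₀ < … < y_c` are elements of `H` with `2 * c ≤ y₀`. If all `c`
gaps were unsettled at level `y₀ / 2`, then continuing the sequence inside `H` by settled gaps
would make the approximation correct (`looksUnsettled_iff`) and give an exactly `ω`-large subset
of `H` of color exactly `c`. Hence one of the gaps is settled, and so `y_c` is settled for `y₀`
(`ThinForColor.settled`).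

Consequently every `(c + 1)`-st element of `H`, from some number computable from `c`, `j` and `e`
on, yields a settled sequence at level `j`, and `e ∈ ∅^(j)` is decided by `approxJump`
(`decodeJump_correct`), uniformly in `H` and `c`.

To have a single functional and a computable coloring, oracle programs are translated into
Mathlib's `Nat.Partrec.Code` with the oracle replaced by a finite list (`OracleCode.toCode`), so
that Mathlib's bounded evaluation `evaln` applies.
-/

/-! ### Primitive recursive list operations -/

namespace Primrec

variable {α β : Type*} [Primcodable α] [Primcodable β]

theorem list_filter_param {f : α → List β} {p : α → β → Bool} (hf : Primrec f)
    (hp : Primrec₂ p) : Primrec fun a => (f a).filter (p a) := by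
  have h : Primrec₂ fun (a : α) (b : β) => if p a b = true then some b else none :=
    ite (Primrec.eq.comp hp (const true)) (option_some.comp snd) (const none)
  refine (listFilterMap hf h).of_eq fun a => ?_
  rw [← List.filterMap_eq_filter]
  congr 1

theorem list_any_param {f : α → List β} {p : α → β → Bool} (hf : Primrec f)
    (hp : Primrec₂ p) : Primrec fun a => (f a).any (p a) := by
  refine (Primrec.not.comp (Primrec.beq.comp (list_length.comp (list_filter_param hf hp))
    (const 0))).of_eq fun a => ?_
  rw [Bool.eq_iff_iff]
  simp

theorem list_contains_nat {f : α → List ℕ} {g : α → ℕ} (hf : Primrec f) (hg : Primrec g) :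
    Primrec fun a => (f a).contains (g a) := by
  refine (list_any_param hf (p := fun a b => g a == b) (Primrec.beq.comp (hg.comp fst) snd)).of_eq
    fun a => ?_
  rw [Bool.eq_iff_iff]
  simp

end Primrec

/-! ### Simulating oracle programs on finite oracles -/

namespace OracleCode

open Nat.Partrec (Code)

/-- Replaces each oracle query of a program by a call of the oracle-free program `d`. Mathlib's
unbounded search `Code.rfind'` starts at the second component of its input, so it is started
at `0`. -/
def toCode (d : Code) : OracleCode → Code
  | zero => .zero
  | succ => .succ
  | left => .left
  | right => .right
  | oracle => d
  | pair a b => .pair (toCode d a) (toCode d b)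
  | comp a b => .comp (toCode d a) (toCode d b)
  | prec a b => .prec (toCode d a) (toCode d b)
  | rfind a => .comp (.rfind' (toCode d a)) (.pair .id .zero)

theorem eval_toCode_rfind (d : Code) (a : OracleCode) (n : ℕ) :
    Code.eval (toCode d (rfind a)) n =
      Nat.rfind fun m => (fun v => decide (v = 0)) <$> Code.eval (toCode d a) (Nat.pair n m) := by
  have h : Code.eval (.pair .id .zero) n = Part.some (Nat.pair n 0) := by
    simp [Code.eval, Seq.seq]
    rfl
  simp only [toCode, Code.eval, Part.bind_eq_bind] at h ⊢
  rw [h]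
  simp [Part.map_id']

/-- One step of the course-of-values recursion for `toCode`: the list holds the translations of
the programs with smaller Gödel numbers. -/
def toCodeStep (d : Code) (l : List Code) : Option Code :=
  let n := l.length
  let m := (n - 5) / 4
  let a := l.getD m.unpair.1 .zero
  let b := l.getD m.unpair.2 .zero
  some <| if n = 0 then .zero else if n = 1 then .succ else if n = 2 then .left
    else if n = 3 then .right else if n = 4 then d
    else if (n - 5) % 4 = 0 then .pair a b
    else if (n - 5) % 4 = 1 then .comp a b
    else if (n - 5) % 4 = 2 then .prec a b
    else .comp (.rfind' (l.getD m .zero)) (.pair .id .zero)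

theorem primrec_toCodeStep : Primrec₂ toCodeStep := by
  have n : Primrec fun p : Code × List Code => p.2.length := Primrec.list_length.comp Primrec.snd
  have n5 : Primrec fun p : Code × List Code => p.2.length - 5 :=
    Primrec.nat_sub.comp n (Primrec.const 5)
  have m : Primrec fun p : Code × List Code => (p.2.length - 5) / 4 :=
    Primrec.nat_div.comp n5 (Primrec.const 4)
  have r : Primrec fun p : Code × List Code => (p.2.length - 5) % 4 :=
    Primrec.nat_mod.comp n5 (Primrec.const 4)
  have look {f : Code × List Code → ℕ} (hf : Primrec f) :
      Primrec fun p : Code × List Code => p.2.getD (f p) Code.zero :=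
    (Primrec.list_getD Code.zero).comp Primrec.snd hf
  have a := look (Primrec.fst.comp (Primrec.unpair.comp m))
  have b := look (Primrec.snd.comp (Primrec.unpair.comp m))
  have is {f : Code × List Code → ℕ} (hf : Primrec f) (k : ℕ) : PrimrecPred fun p => f p = k :=
    Primrec.eq.comp hf (Primrec.const k)
  exact Primrec.option_some.comp <|
    .ite (is n 0) (.const _) <| .ite (is n 1) (.const _) <| .ite (is n 2) (.const _) <|
    .ite (is n 3) (.const _) <| .ite (is n 4) .fst <|
    .ite (is r 0) (Code.primrec₂_pair.comp a b) <|
    .ite (is r 1) (Code.primrec₂_comp.comp a b) <|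
    .ite (is r 2) (Code.primrec₂_prec.comp a b) <|
    Code.primrec₂_comp.comp (Code.primrec_rfind'.comp (look m)) (.const _)

theorem toCodeStep_eq (d : Code) (n : ℕ) :
    toCodeStep d ((List.range n).map fun i => toCode d (ofNat i)) = some (toCode d (ofNat n)) := by
  match n with
  | 0 | 1 | 2 | 3 | 4 => simp [toCodeStep, ofNat, toCode]
  | n + 5 =>
    have h : n / 4 < n + 5 := by omega
    have h₁ : (n / 4).unpair.1 < n + 5 := (Nat.unpair_left_le _).trans_lt h
    have h₂ : (n / 4).unpair.2 < n + 5 := (Nat.unpair_right_le _).trans_lt h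
    have hr : n % 4 < 4 := Nat.mod_lt _ (by norm_num)
    rw [ofNat]
    generalize hm : n % 4 = r at hr ⊢
    interval_cases r <;> simp [toCodeStep, toCode, hm, h, h₁, h₂, List.getD]

theorem primrec_toCode_ofNat : Primrec₂ fun d n => toCode d (ofNat n) :=
  Primrec.nat_strong_rec _ primrec_toCodeStep toCodeStep_eq

theorem mem_pair_seq {p q : Part ℕ} {v : ℕ} :
    v ∈ Nat.pair <$> p <*> q ↔ ∃ x ∈ p, ∃ y ∈ q, v = Nat.pair x y := by
  simp [Seq.seq, eq_comm]

theorem mem_rfind_eq_zero {p : ℕ → Part ℕ} {v : ℕ} :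
    (v ∈ Nat.rfind fun n => (fun m => decide (m = 0)) <$> p n) ↔
      0 ∈ p v ∧ ∀ m < v, ∃ x ∈ p m, x ≠ 0 := by
  refine Nat.mem_rfind.trans ?_
  simp

section MemEval

variable {g : ℕ → ℕ} {d : Code} {a b : OracleCode} {n v x y : ℕ}

theorem mem_eval_pair :
    v ∈ eval g (pair a b) n ↔ ∃ x ∈ eval g a n, ∃ y ∈ eval g b n, v = Nat.pair x y :=
  mem_pair_seq

theorem mem_eval_comp : v ∈ eval g (comp a b) n ↔ ∃ x ∈ eval g b n, v ∈ eval g a x :=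
  Part.mem_bind_iff

theorem eval_prec_zero : eval g (prec a b) (Nat.pair x 0) = eval g a x := by
  simp [eval]

theorem mem_eval_prec_succ : v ∈ eval g (prec a b) (Nat.pair x (y + 1)) ↔
    ∃ i ∈ eval g (prec a b) (Nat.pair x y), v ∈ eval g b (Nat.pair x (Nat.pair y i)) := by
  simp [eval]

theorem mem_eval_rfind : v ∈ eval g (rfind a) n ↔
    0 ∈ eval g a (Nat.pair n v) ∧ ∀ m < v, ∃ x ∈ eval g a (Nat.pair n m), x ≠ 0 :=
  mem_rfind_eq_zero

theorem mem_eval_toCode_pair : v ∈ (toCode d (pair a b)).eval n ↔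
    ∃ x ∈ (toCode d a).eval n, ∃ y ∈ (toCode d b).eval n, v = Nat.pair x y :=
  mem_pair_seq

theorem mem_eval_toCode_comp : v ∈ (toCode d (comp a b)).eval n ↔
    ∃ x ∈ (toCode d b).eval n, v ∈ (toCode d a).eval x :=
  Part.mem_bind_iff

theorem eval_toCode_prec_zero :
    (toCode d (prec a b)).eval (Nat.pair x 0) = (toCode d a).eval x :=
  Code.eval_prec_zero _ _ _

theorem mem_eval_toCode_prec_succ : v ∈ (toCode d (prec a b)).eval (Nat.pair x (y + 1)) ↔
    ∃ i ∈ (toCode d (prec a b)).eval (Nat.pair x y),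
      v ∈ (toCode d b).eval (Nat.pair x (Nat.pair y i)) := by
  rw [toCode, Code.eval_prec_succ]
  exact Part.mem_bind_iff

theorem mem_eval_toCode_rfind : v ∈ (toCode d (rfind a)).eval n ↔
    0 ∈ (toCode d a).eval (Nat.pair n v) ∧
      ∀ m < v, ∃ x ∈ (toCode d a).eval (Nat.pair n m), x ≠ 0 := by
  rw [eval_toCode_rfind]
  exact mem_rfind_eq_zero

end MemEval

/-- A simulation with a correct partial oracle is correct. -/
theorem mem_eval_of_mem_eval_toCode {g : ℕ → ℕ} {d : Code}
    (hd : ∀ n, ∀ v ∈ Code.eval d n, v = g n) (c : OracleCode) :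
    ∀ n, ∀ v ∈ Code.eval (toCode d c) n, v ∈ eval g c n := by
  induction c with
  | zero | succ | left | right => exact fun n v hv => hv
  | oracle => exact fun n v hv => Part.mem_some_iff.2 (hd n v hv)
  | pair a b iha ihb =>
    intro n v hv
    obtain ⟨x, hx, y, hy, rfl⟩ := mem_eval_toCode_pair.1 hv
    exact mem_eval_pair.2 ⟨x, iha _ _ hx, y, ihb _ _ hy, rfl⟩
  | comp a b iha ihb =>
    intro n v hv
    obtain ⟨x, hx, hv⟩ := mem_eval_toCode_comp.1 hv
    exact mem_eval_comp.2 ⟨x, ihb _ _ hx, iha _ _ hv⟩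
  | prec a b iha ihb =>
    intro n
    rw [← Nat.pair_unpair n]
    induction n.unpair.2 with
    | zero =>
      rw [eval_toCode_prec_zero, eval_prec_zero]
      exact iha _
    | succ y ih =>
      intro v hv
      obtain ⟨i, hi, hv⟩ := mem_eval_toCode_prec_succ.1 hv
      exact mem_eval_prec_succ.2 ⟨i, ih i hi, ihb _ _ hv⟩
  | rfind a iha =>
    intro n v hv
    obtain ⟨h₀, h⟩ := mem_eval_toCode_rfind.1 hv
    refine mem_eval_rfind.2 ⟨iha _ _ h₀, fun m hm => ?_⟩
    obtain ⟨x, hx, hne⟩ := h m hm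
    exact ⟨x, iha _ _ hx, hne⟩

open Filter in
/-- The use principle: a halting oracle computation queries only finitely many values of the
oracle, so it is reproduced by every large enough finite part of it. -/
theorem eventually_mem_eval_toCode {g : ℕ → ℕ} {d : ℕ → Code}
    (hd : ∀ u, ∀ n < u, g n ∈ Code.eval (d u) n) (c : OracleCode) :
    ∀ n, ∀ v ∈ eval g c n, ∀ᶠ u in atTop, v ∈ Code.eval (toCode (d u) c) n := by
  induction c with
  | zero | succ | left | right => exact fun n v hv => Eventually.of_forall fun _ => hv
  | oracle =>
    intro n v hv
    obtain rfl := Part.mem_some_iff.1 hv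
    filter_upwards [eventually_gt_atTop n] with u hu using hd u n hu
  | pair a b iha ihb =>
    intro n v hv
    obtain ⟨x, hx, y, hy, rfl⟩ := mem_eval_pair.1 hv
    filter_upwards [iha _ _ hx, ihb _ _ hy] with u h₁ h₂
    exact mem_eval_toCode_pair.2 ⟨x, h₁, y, h₂, rfl⟩
  | comp a b iha ihb =>
    intro n v hv
    obtain ⟨x, hx, hv⟩ := mem_eval_comp.1 hv
    filter_upwards [ihb _ _ hx, iha _ _ hv] with u h₁ h₂
    exact mem_eval_toCode_comp.2 ⟨x, h₁, h₂⟩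
  | prec a b iha ihb =>
    intro n
    rw [← Nat.pair_unpair n]
    induction n.unpair.2 with
    | zero =>
      simp only [eval_toCode_prec_zero, eval_prec_zero]
      exact iha _
    | succ y ih =>
      intro v hv
      obtain ⟨i, hi, hv⟩ := mem_eval_prec_succ.1 hv
      filter_upwards [ih i hi, ihb _ _ hv] with u h₁ h₂
      exact mem_eval_toCode_prec_succ.2 ⟨i, h₁, h₂⟩
  | rfind a iha =>
    intro n v hv
    obtain ⟨h₀, h⟩ := mem_eval_rfind.1 hv
    have hall : ∀ᶠ u in atTop, ∀ m ∈ Set.Iio v,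
        ∃ x ∈ (toCode (d u) a).eval (Nat.pair n m), x ≠ 0 := by
      rw [Filter.eventually_all_finite (Set.finite_Iio v)]
      intro m hm
      obtain ⟨x, hx, hne⟩ := h m hm
      filter_upwards [iha _ _ hx] with u hu using ⟨x, hu, hne⟩
    filter_upwards [iha _ _ h₀, hall] with u h₁ h₂
    exact mem_eval_toCode_rfind.2 ⟨h₁, h₂⟩

/-- A program that looks up the `i`-th entry of the list `σ` on input `⟨σ, i⟩`, and diverges if
there is none. -/
theorem exists_lookupCode : ∃ d : Code, ∀ (σ : List ℕ) (i : ℕ),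
    Code.eval d (Nat.pair (Encodable.encode σ) i) = (σ[i]? : Part ℕ) := by
  have h : Nat.Partrec fun p => (((Encodable.decode (α := List ℕ) p.unpair.1).bind
      fun σ => σ[p.unpair.2]? : Option ℕ) : Part ℕ) := by
    refine Partrec.nat_iff.1 (Computable.ofOption (Primrec.to_comp ?_))
    refine Primrec.option_bind (Primrec.decode.comp (Primrec.fst.comp Primrec.unpair)) ?_
    exact Primrec.list_getElem?.comp Primrec.snd
      (Primrec.snd.comp (Primrec.unpair.comp Primrec.fst))
  obtain ⟨d, hd⟩ := Code.exists_code.1 h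
  exact ⟨d, fun σ i => by simp [hd]⟩

/-- A fixed program for looking up entries of finite oracles. -/
noncomputable def lookupCode : Code := exists_lookupCode.choose

theorem eval_lookupCode (σ : List ℕ) (i : ℕ) :
    Code.eval (lookupCode.curry (Encodable.encode σ)) i = (σ[i]? : Part ℕ) := by
  rw [Code.eval_curry]
  exact exists_lookupCode.choose_spec σ i

/-- `Φ_e^g(e)` halts within `k.unpair.2` steps, when only the first `k.unpair.1` values of the
oracle may be queried. A single number `k` bounds both resources, so that halting is
`∃ k, haltsWithin g e k`. -/
noncomputable def haltsWithin (g : ℕ → ℕ) (e k : ℕ) : Bool :=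
  (Code.evaln k.unpair.2 (toCode (lookupCode.curry
    (Encodable.encode ((List.range k.unpair.1).map g))) (ofNat e)) e).isSome

theorem haltsWithin_congr {g g' : ℕ → ℕ} {e k : ℕ} (h : ∀ i < k, g i = g' i) :
    haltsWithin g e k = haltsWithin g' e k := by
  have : (List.range k.unpair.1).map g = (List.range k.unpair.1).map g' :=
    List.map_congr_left fun i hi =>
      h i ((List.mem_range.1 hi).trans_le (Nat.unpair_left_le k))
  rw [haltsWithin, haltsWithin, this]

theorem eval_dom_iff_exists_haltsWithin (g : ℕ → ℕ) (e : ℕ) :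
    (eval g (ofNat e) e).Dom ↔ ∃ k, haltsWithin g e k = true := by
  rw [Part.dom_iff_mem]
  constructor
  · rintro ⟨v, hv⟩
    obtain ⟨u, hu⟩ := (eventually_mem_eval_toCode (g := g)
      (d := fun u => lookupCode.curry (Encodable.encode ((List.range u).map g)))
      (fun u n hn => by rw [eval_lookupCode]; simp [hn]) (ofNat e) e v hv).exists
    obtain ⟨s, hs⟩ := Code.evaln_complete.1 hu
    refine ⟨Nat.pair u s, ?_⟩
    rw [haltsWithin, Nat.unpair_pair]
    exact Option.isSome_iff_exists.2 ⟨v, hs⟩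
  · rintro ⟨k, hk⟩
    obtain ⟨v, hv⟩ := Option.isSome_iff_exists.1 hk
    refine ⟨v, mem_eval_of_mem_eval_toCode (fun n w hw => ?_) _ _ _ (Code.evaln_sound hv)⟩
    simp only [eval_lookupCode, Part.mem_ofOption, Option.mem_def, List.getElem?_map,
      Option.map_eq_some_iff] at hw
    obtain ⟨i, hi, rfl⟩ := hw
    rw [List.getElem?_eq_some_iff] at hi
    obtain ⟨_, rfl⟩ := hi
    simp

/-! ### Uniform oracle computations -/

theorem exists_eval_eq_of_partrec {f : ℕ →. ℕ} (hf : Nat.Partrec f) :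
    ∃ c : OracleCode, ∀ g, eval g c = f := by
  induction hf with
  | zero => exact ⟨zero, fun _ => rfl⟩
  | succ => exact ⟨succ, fun _ => rfl⟩
  | left => exact ⟨left, fun _ => rfl⟩
  | right => exact ⟨right, fun _ => rfl⟩
  | pair _ _ iha ihb =>
    obtain ⟨a, ha⟩ := iha
    obtain ⟨b, hb⟩ := ihb
    exact ⟨pair a b, fun g => by simp only [eval, ha, hb]; rfl⟩
  | comp _ _ iha ihb =>
    obtain ⟨a, ha⟩ := iha
    obtain ⟨b, hb⟩ := ihb
    exact ⟨comp a b, fun g => by simp only [eval, ha, hb]; rfl⟩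
  | prec _ _ iha ihb =>
    obtain ⟨a, ha⟩ := iha
    obtain ⟨b, hb⟩ := ihb
    exact ⟨prec a b, fun g => by simp only [eval, ha, hb]; rfl⟩
  | rfind _ iha =>
    obtain ⟨a, ha⟩ := iha
    exact ⟨rfind a, fun g => by simp only [eval, ha]; rfl⟩

theorem exists_eval_eq_of_computable {f : ℕ → ℕ} (hf : Computable f) :
    ∃ c : OracleCode, ∀ g n, eval g c n = Part.some (f n) := by
  obtain ⟨c, hc⟩ := exists_eval_eq_of_partrec (Partrec.nat_iff.1 hf.partrec)
  exact ⟨c, fun g n => by rw [hc]; rfl⟩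

theorem eval_comp_of_eq_some {g : ℕ → ℕ} {a b : OracleCode} {n v : ℕ}
    (h : eval g b n = Part.some v) : eval g (comp a b) n = eval g a v := by
  ext w
  simp [mem_eval_comp, h]

theorem eval_pair_of_eq_some {g : ℕ → ℕ} {a b : OracleCode} {n v w : ℕ}
    (ha : eval g a n = Part.some v) (hb : eval g b n = Part.some w) :
    eval g (pair a b) n = Part.some (Nat.pair v w) := by
  ext u
  simp [mem_eval_pair, ha, hb]

/-- The first `k` values of the oracle can be computed as a list, uniformly in the oracle. -/
theorem exists_eval_eq_prefix : ∃ c : OracleCode, ∀ (g : ℕ → ℕ) (x k : ℕ),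
    eval g c (Nat.pair x k) = Part.some (Encodable.encode ((List.range k).map g)) := by
  -- from `⟨a, ⟨y, i⟩⟩` and `g y`, append `g y` to the list coded by `i`
  have hstep : Computable fun p : ℕ => Encodable.encode
      (((Encodable.decode (α := List ℕ) p.unpair.1.unpair.2.unpair.2).getD []) ++ [p.unpair.2]) := by
    refine Primrec.to_comp (Primrec.encode.comp (Primrec.list_concat.comp ?_
      (Primrec.snd.comp Primrec.unpair)))
    have h₂ : Primrec fun p : ℕ => p.unpair.2 := Primrec.snd.comp Primrec.unpair
    exact Primrec.option_getD.comp (Primrec.decode.comp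
      (h₂.comp (h₂.comp (Primrec.fst.comp Primrec.unpair)))) (Primrec.const [])
  obtain ⟨s, hs⟩ := exists_eval_eq_of_computable hstep
  obtain ⟨z, hz⟩ := exists_eval_eq_of_computable
    (Computable.const (α := ℕ) (Encodable.encode ([] : List ℕ)))
  obtain ⟨i, hi⟩ := exists_eval_eq_of_computable (f := fun n => n) Computable.id
  refine ⟨prec z (comp s (pair i (comp oracle (comp left right)))), fun g x k => ?_⟩
  induction k with
  | zero => simp [eval_prec_zero, hz]
  | succ k ih =>
    rw [Part.eq_some_iff, mem_eval_prec_succ]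
    refine ⟨_, Part.eq_some_iff.1 ih, ?_⟩
    generalize hl : Encodable.encode ((List.range k).map g) = l
    have hr : eval g right (Nat.pair x (Nat.pair k l)) = Part.some (Nat.pair k l) := by
      simp [eval]
    have hk : eval g (comp left right) (Nat.pair x (Nat.pair k l)) = Part.some k := by
      rw [eval_comp_of_eq_some hr]
      simp [eval]
    have ho : eval g (comp oracle (comp left right)) (Nat.pair x (Nat.pair k l)) =
        Part.some (g k) := by
      rw [eval_comp_of_eq_some hk]
      rfl
    rw [eval_comp_of_eq_some (eval_pair_of_eq_some (hi g _) ho), hs]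
    simp [← hl, List.range_succ]

/-- A functional given by its answers on finite initial segments of the oracle, found by
searching for a long enough segment. -/
theorem exists_eval_eq_of_prefix {G : ℕ → List ℕ → Option ℕ} (hG : Computable₂ G) :
    ∃ Φ : OracleCode, ∀ (g : ℕ → ℕ) (x v : ℕ),
      (∃ k, (G x ((List.range k).map g)).isSome) →
      (∀ k, ∀ w ∈ G x ((List.range k).map g), w = v) → eval g Φ x = Part.some v := by
  have hT : Computable fun p : ℕ =>
      G p.unpair.1 ((Encodable.decode (α := List ℕ) p.unpair.2).getD []) := by
    have h₁ : Primrec fun p : ℕ => p.unpair.1 := Primrec.fst.comp Primrec.unpair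
    refine hG.comp h₁.to_comp (Primrec.to_comp ?_)
    exact Primrec.option_getD.comp (Primrec.decode.comp (Primrec.snd.comp Primrec.unpair))
      (Primrec.const [])
  obtain ⟨t, ht⟩ := exists_eval_eq_of_computable (f := fun p =>
      if (G p.unpair.1 ((Encodable.decode (α := List ℕ) p.unpair.2).getD [])).isSome then 0 else 1)
    (((Primrec.dom_bool fun b => if b then 0 else 1).to_comp.comp
      (Primrec.option_isSome.to_comp.comp hT)).of_eq fun _ => rfl)
  obtain ⟨o, ho⟩ := exists_eval_eq_of_computable (f := fun p =>
      (G p.unpair.1 ((Encodable.decode (α := List ℕ) p.unpair.2).getD [])).getD 0)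
    (Primrec.option_getD.to_comp.comp hT (Computable.const 0))
  obtain ⟨i, hi⟩ := exists_eval_eq_of_computable (f := fun n => n) Computable.id
  obtain ⟨q, hq⟩ := exists_eval_eq_prefix
  have hin (g : ℕ → ℕ) (x k : ℕ) : eval g (pair left q) (Nat.pair x k) =
      Part.some (Nat.pair x (Encodable.encode ((List.range k).map g))) :=
    eval_pair_of_eq_some (by simp [eval]) (hq g x k)
  refine ⟨comp (comp o (pair left q)) (pair i (rfind (comp t (pair left q)))),
    fun g x v hex hall => ?_⟩
  classical
  have hfind : eval g (rfind (comp t (pair left q))) x = Part.some (Nat.find hex) := by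
    rw [Part.eq_some_iff, mem_eval_rfind]
    simp only [eval_comp_of_eq_some (hin g x _), ht]
    refine ⟨?_, fun {m} hm => ?_⟩
    · simp [Nat.find_spec hex]
    · simp [Nat.find_min hex hm]
  obtain ⟨w, hw⟩ := Option.isSome_iff_exists.1 (Nat.find_spec hex)
  rw [eval_comp_of_eq_some (eval_pair_of_eq_some (hi g x) hfind)]
  rw [eval_comp_of_eq_some (hin g x _), ho]
  simp [hw, hall _ w hw]

end OracleCode

/-! ### Approximating the iterated jumps along settled sequences -/

open OracleCode

theorem mem_iteratedJump_succ {X : Set ℕ} {j e : ℕ} : e ∈ iteratedJump (j + 1) X ↔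
    ∃ k, haltsWithin (charFn (iteratedJump j X)) e k = true := by
  rw [iteratedJump, Function.iterate_succ_apply']
  exact eval_dom_iff_exists_haltsWithin _ _

/-- The characteristic function of the set of entries of a list. -/
def listChar (L : List ℕ) (i : ℕ) : ℕ := if L.contains i then 1 else 0

theorem listChar_eq_charFn {L : List ℕ} {X : Set ℕ} {i : ℕ} (h : i ∈ L ↔ i ∈ X) :
    listChar L i = charFn X i := by
  by_cases hi : i ∈ X
  · simp [listChar, charFn, hi, h.2 hi]
  · simp [listChar, charFn, hi, h]

/-- The jump of the finite set `L`, with all resources bounded by `z`. -/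
noncomputable def boundedJump (z : ℕ) (L : List ℕ) : List ℕ :=
  (List.range z).filter fun e => (List.range z).any fun k => haltsWithin (listChar L) e k

/-- The approximation of `∅^(j)` given by bounds `z₁, …, z_j`: the bounds are those of the
successive jumps, the last one being used for the innermost jump. -/
noncomputable def approxJump (zs : List ℕ) : List ℕ := zs.foldr boundedJump []

/-- `y` bounds the computations that put numbers below `x` into one of the first `l` jumps
of `∅`. -/
def Settled (l x y : ℕ) : Prop :=
  x ≤ y ∧ ∀ j < l, ∀ e < x, e ∈ iteratedJump (j + 1) ∅ →
    ∃ k < y, haltsWithin (charFn (iteratedJump j ∅)) e k = true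

theorem Settled.mono {l l' x x' y y' : ℕ} (h : Settled l x y) (hl : l' ≤ l) (hx : x' ≤ x)
    (hy : y ≤ y') : Settled l' x' y' := by
  refine ⟨hx.trans (h.1.trans hy), fun j hj e he hej => ?_⟩
  obtain ⟨k, hk, hke⟩ := h.2 j (hj.trans_le hl) e (he.trans_le hx) hej
  exact ⟨k, hk.trans_le hy, hke⟩

theorem exists_settled (l x : ℕ) : ∃ y, Settled l x y := by
  classical
  have h (p : ℕ × ℕ) : ∃ k, p.2 ∈ iteratedJump (p.1 + 1) ∅ →
      haltsWithin (charFn (iteratedJump p.1 ∅)) p.2 k = true := by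
    by_cases hp : p.2 ∈ iteratedJump (p.1 + 1) ∅
    · exact (mem_iteratedJump_succ.1 hp).imp fun k hk _ => hk
    · exact ⟨0, fun h => absurd h hp⟩
  choose k hk using h
  refine ⟨max x (((Finset.range l ×ˢ Finset.range x).sup k) + 1), le_max_left _ _,
    fun j hj e he hej => ⟨k (j, e), ?_, hk (j, e) hej⟩⟩
  refine lt_max_of_lt_right (Nat.lt_succ_of_le (Finset.le_sup (f := k) ?_))
  simp [hj, he]

theorem mem_boundedJump {z e : ℕ} {L : List ℕ} : e ∈ boundedJump z L ↔
    e < z ∧ ∃ k < z, haltsWithin (listChar L) e k = true := by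
  simp [boundedJump]

theorem mem_boundedJump_iff {z e : ℕ} {L : List ℕ} {X : Set ℕ}
    (h : ∀ i < z, (i ∈ L ↔ i ∈ X)) : e ∈ boundedJump z L ↔
      e < z ∧ ∃ k < z, haltsWithin (charFn X) e k = true := by
  rw [mem_boundedJump]
  refine and_congr_right fun _ => exists_congr fun k => and_congr_right fun hk => ?_
  rw [haltsWithin_congr fun i hi => listChar_eq_charFn (h i (hi.trans hk))]

/-- Along a settled sequence the approximation is correct below the starting point. -/
theorem mem_approxJump_iff {l : ℕ} {zs : List ℕ} : ∀ {z₀ e : ℕ},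
    (z₀ :: zs).IsChain (Settled l) → zs.length ≤ l → e < z₀ →
      (e ∈ approxJump zs ↔ e ∈ iteratedJump zs.length ∅) := by
  induction zs with
  | nil => simp [approxJump, iteratedJump]
  | cons z zs ih =>
    intro z₀ e h hl he
    rw [List.isChain_cons_cons] at h
    have hl' : zs.length < l := hl
    change e ∈ boundedJump z (approxJump zs) ↔ _
    rw [mem_boundedJump_iff fun i hi => ih h.2 hl'.le hi, List.length_cons]
    constructor
    · rintro ⟨-, k, -, hk⟩
      exact mem_iteratedJump_succ.2 ⟨k, hk⟩
    · exact fun hj => ⟨he.trans_le h.1.1, h.1.2 _ hl' e he hj⟩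

/-! ### The coloring -/

/-- Whether, according to the approximation given by the bounds `zs`, some computation that puts
a number below `x` into a jump of `∅` is not bounded by `y`. -/
noncomputable def looksUnsettled (zs : List ℕ) (x y : ℕ) : Bool :=
  (List.range (zs.length + 1)).any fun j => (List.range x).any fun e =>
    (approxJump (zs.take j)).contains e && !(boundedJump y (approxJump (zs.take j).tail)).contains e

theorem looksUnsettled_iff {x y : ℕ} {zs : List ℕ} (hxy : x ≤ y)
    (h : (y :: zs).IsChain (Settled zs.length)) :
    looksUnsettled zs x y = true ↔ ¬ Settled zs.length x y := by
  have key (j : ℕ) (hj : j < zs.length) (e : ℕ) (he : e < x) :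
      (e ∈ approxJump (zs.take (j + 1)) ∧
        e ∉ boundedJump y (approxJump (zs.take (j + 1)).tail)) ↔
      (e ∈ iteratedJump (j + 1) ∅ ∧
        ¬ ∃ k < y, haltsWithin (charFn (iteratedJump j ∅)) e k = true) := by
    cases zs with
    | nil => simp at hj
    | cons z ws =>
      have hjl : j ≤ ws.length := Nat.lt_succ_iff.1 hj
      have hlen : (ws.take j).length = j := by simp [hjl]
      have hc : (y :: z :: ws.take j).IsChain (Settled (z :: ws).length) := by
        simpa using h.take (j + 2)
      have h₁ := mem_approxJump_iff hc (by simp [hjl]) (he.trans_le hxy)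
      have h₂ : ∀ i < y, (i ∈ approxJump (ws.take j) ↔ i ∈ iteratedJump j ∅) := fun i hi => by
        have := mem_approxJump_iff (List.isChain_cons_cons.1 hc).2 (by simp)
          (hi.trans_le (List.isChain_cons_cons.1 hc).1.1)
        rwa [hlen] at this
      rw [List.length_cons, hlen] at h₁
      rw [List.take_succ_cons, List.tail_cons, h₁, mem_boundedJump_iff h₂,
        and_iff_right (he.trans_le hxy)]
  constructor
  · intro hu hs
    simp only [looksUnsettled, List.any_eq_true, List.mem_range, Bool.and_eq_true,
      Bool.not_eq_true', List.contains_iff_mem, ← Bool.not_eq_true] at hu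
    obtain ⟨j, hj, e, he, h'⟩ := hu
    cases j with
    | zero => simp [approxJump] at h'
    | succ j =>
      have hj' : j < zs.length := Nat.lt_of_succ_lt_succ hj
      obtain ⟨h₁, h₂⟩ := (key j hj' e he).1 h'
      exact h₂ (hs.2 j hj' e he h₁)
  · intro hs
    simp only [Settled, hxy, true_and, not_forall] at hs
    obtain ⟨j, hj, e, he, h₁, h₂⟩ := hs
    simp only [looksUnsettled, List.any_eq_true, List.mem_range, Bool.and_eq_true,
      Bool.not_eq_true', List.contains_iff_mem, ← Bool.not_eq_true]
    exact ⟨j + 1, Nat.succ_lt_succ hj, e, he, (key j hj e he).2 ⟨h₁, h₂⟩⟩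

/-- The color of `x₀ < x₁ < … < x_m`, where `m = x₀`: the last `m / 2` entries are bounds for
approximating the first `m / 2` jumps of `∅`, and the color is the number of pairs of consecutive
entries among the remaining ones that look unsettled. -/
noncomputable def unsettledCount (l : List ℕ) : ℕ :=
  ((List.range (l.headI - l.headI / 2)).filter fun i =>
    looksUnsettled (l.drop (l.headI - l.headI / 2 + 1)) (l.getD i 0) (l.getD (i + 1) 0)).length

/-- The coloring of the exactly `ω`-large sets by the number of unsettled gaps. -/
noncomputable def unsettledColoring (s : SchreierBarrier) : ℕ :=
  unsettledCount (s.1.sort (· ≤ ·))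

theorem isChain_map_range {R : ℕ → ℕ → Prop} {g : ℕ → ℕ} {n : ℕ}
    (h : ∀ i < n, R (g i) (g (i + 1))) : ((List.range (n + 1)).map g).IsChain R := by
  rw [List.isChain_iff_getElem]
  intro i hi
  simp only [List.length_map, List.length_range] at hi
  simpa using h i (by omega)

theorem length_filter_range_lt {c r : ℕ} (h : c ≤ r) {p : ℕ → Bool}
    (hp : ∀ i < r, (p i = true ↔ i < c)) : ((List.range r).filter p).length = c := by
  obtain ⟨d, rfl⟩ := Nat.exists_eq_add_of_le h
  rw [List.range_add, List.filter_append, List.filter_eq_self.2, List.filter_eq_nil_iff.2]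
  · simp
  · intro a ha
    obtain ⟨i, hi, rfl⟩ := List.mem_map.1 ha
    rw [hp _ (by simpa using hi)]
    omega
  · intro a ha
    have := List.mem_range.1 ha
    exact (hp a (by omega)).2 this

/-- If precisely the first `c` gaps of a sequence are unsettled, its color is `c`. -/
theorem unsettledCount_map_range {x : ℕ → ℕ} {c : ℕ} (hx : StrictMono x) (hc : 2 * c ≤ x 0)
    (h₁ : ∀ i < c, ¬ Settled (x 0 / 2) (x i) (x (i + 1)))
    (h₂ : ∀ i, c ≤ i → Settled (x 0 / 2) (x i) (x (i + 1))) :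
    unsettledCount ((List.range (x 0 + 1)).map x) = c := by
  have hhead : ((List.range (x 0 + 1)).map x).headI = x 0 := by
    simp [List.range_succ_eq_map]
  rw [unsettledCount, hhead]
  generalize hr : x 0 - x 0 / 2 = r
  have hcr : c ≤ r := by omega
  have hzs : ((List.range (x 0 + 1)).map x).drop (r + 1) =
      (List.range (x 0 / 2)).map fun i => x (r + 1 + i) := by
    refine List.ext_getElem (by simp; omega) fun i _ _ => by simp
  refine length_filter_range_lt hcr fun i hi => ?_
  have hgetD (i : ℕ) (hi : i < x 0 + 1) : ((List.range (x 0 + 1)).map x).getD i 0 = x i := by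
    simp [List.getD, hi]
  rw [hzs, hgetD i (by omega), hgetD (i + 1) (by omega)]
  have hchain : (x (i + 1) :: (List.range (x 0 / 2)).map fun i => x (r + 1 + i)).IsChain
      (Settled (x 0 / 2)) := by
    have := isChain_map_range (R := Settled (x 0 / 2)) (n := x 0 / 2)
      (g := fun k => if k = 0 then x (i + 1) else x (r + k)) fun k _ => by
        rcases Nat.eq_zero_or_pos k with rfl | hk
        · simpa using (h₂ r hcr).mono le_rfl (hx.monotone (by omega)) le_rfl
        · simpa [hk.ne', add_assoc] using h₂ (r + k) (by omega)
    rw [List.range_succ_eq_map] at this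
    simpa [Function.comp_def, Nat.succ_eq_add_one, add_assoc, add_comm, add_left_comm] using this
  have hiff := looksUnsettled_iff (zs := (List.range (x 0 / 2)).map fun i => x (r + 1 + i))
    (hx.monotone (Nat.le_succ i)) (by simpa using hchain)
  rw [hiff]
  simp only [List.length_map, List.length_range]
  constructor
  · intro h
    by_contra hci
    exact h (h₂ i (not_lt.1 hci))
  · exact h₁ i

/-- A strictly increasing sequence provides an exactly `ω`-large set, of color the color of
its list of elements. -/
theorem exists_schreier_of_strictMono {x : ℕ → ℕ} (hx : StrictMono x) :
    ∃ s : SchreierBarrier, (∀ a ∈ s.1, ∃ i, x i = a) ∧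
      unsettledColoring s = unsettledCount ((List.range (x 0 + 1)).map x) := by
  have hp : ((List.range (x 0 + 1)).map x).Pairwise (· < ·) :=
    List.pairwise_map.2 (List.pairwise_lt_range.imp fun h => hx h)
  have hnd : ((List.range (x 0 + 1)).map x).Nodup := hp.imp fun h => h.ne
  have hmem : x 0 ∈ ((List.range (x 0 + 1)).map x).toFinset := by
    simp only [List.mem_toFinset, List.mem_map, List.mem_range]
    exact ⟨0, by omega, rfl⟩
  refine ⟨⟨((List.range (x 0 + 1)).map x).toFinset, ⟨_, hmem⟩, ?_⟩, ?_, ?_⟩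
  · rw [List.toFinset_card_of_nodup hnd, List.length_map, List.length_range]
    refine (add_comm _ _).trans (congrArg (1 + ·) ?_)
    refine le_antisymm (Finset.le_min' _ _ _ fun a ha => ?_) (Finset.min'_le _ _ hmem)
    simp only [List.mem_toFinset, List.mem_map] at ha
    obtain ⟨i, -, rfl⟩ := ha
    exact hx.monotone (Nat.zero_le i)
  · intro a ha
    simp only [List.mem_toFinset, List.mem_map] at ha
    obtain ⟨i, -, rfl⟩ := ha
    exact ⟨i, rfl⟩
  · rw [unsettledColoring]
    congr 1
    exact (List.toFinset_sort (· ≤ ·) hnd).2 (hp.imp fun h => h.le)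

/-! ### Thin sets are sparse -/

/-- Among any `c` consecutive gaps in an infinite set that avoids the color `c` one is settled:
otherwise a continuation with settled gaps would have color `c`. -/
theorem ThinForColor.exists_settled_gap {H : Set ℕ} {c : ℕ} (hH : H.Infinite)
    (hc : ThinForColor unsettledColoring H c) {y : ℕ → ℕ} (hy : ∀ i < c, y i < y (i + 1))
    (hyH : ∀ i ≤ c, y i ∈ H) (h₀ : 2 * c ≤ y 0) :
    ∃ i < c, Settled (y 0 / 2) (y i) (y (i + 1)) := by
  by_contra! hcon
  have hnext (a : ℕ) : ∃ b ∈ H, a < b ∧ Settled (y 0 / 2) a b := by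
    obtain ⟨m, hm⟩ := exists_settled (y 0 / 2) a
    obtain ⟨b, hb, hlt⟩ := hH.exists_gt (max a m)
    exact ⟨b, hb, (le_max_left _ _).trans_lt hlt,
      hm.mono le_rfl le_rfl ((le_max_right _ _).trans hlt.le)⟩
  choose nx hnxH hnxlt hnxs using hnext
  let x (i : ℕ) : ℕ := nx^[i - c] (y (min i c))
  have hx₁ (i : ℕ) (hi : i ≤ c) : x i = y i := by
    simp [x, hi, Nat.sub_eq_zero_of_le hi]
  have hx₂ (i : ℕ) (hi : c ≤ i) : x (i + 1) = nx (x i) := by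
    simp only [x, min_eq_right hi, min_eq_right (hi.trans (Nat.le_succ i)), Nat.succ_sub hi,
      Function.iterate_succ_apply']
  have hx : StrictMono x := strictMono_nat_of_lt_succ fun i => by
    rcases lt_or_ge i c with hi | hi
    · rw [hx₁ i hi.le, hx₁ (i + 1) hi]
      exact hy i hi
    · rw [hx₂ i hi]
      exact hnxlt _
  have hxH (i : ℕ) : x i ∈ H := by
    rcases le_or_gt i c with hi | hi
    · rw [hx₁ i hi]
      exact hyH i hi
    · obtain ⟨k, rfl⟩ := Nat.exists_eq_succ_of_ne_zero (Nat.ne_zero_of_lt hi)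
      rw [Nat.succ_eq_add_one, hx₂ k (Nat.le_of_lt_succ hi)]
      exact hnxH _
  obtain ⟨s, hs, hcol⟩ := exists_schreier_of_strictMono hx
  refine hc ⟨s, fun a ha => ?_, hcol.trans (unsettledCount_map_range hx ?_ ?_ ?_)⟩
  · obtain ⟨i, rfl⟩ := hs a ha
    exact hxH i
  · rwa [hx₁ 0 (Nat.zero_le c)]
  · intro i hi
    rw [hx₁ 0 (Nat.zero_le c), hx₁ i hi.le, hx₁ (i + 1) hi]
    exact hcon i hi
  · intro i hi
    rw [hx₁ 0 (Nat.zero_le c), hx₂ i hi]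
    exact hnxs _

theorem ThinForColor.settled {H : Set ℕ} {c : ℕ} (hH : H.Infinite)
    (hc : ThinForColor unsettledColoring H c) {y : ℕ → ℕ} (hy : ∀ i < c, y i < y (i + 1))
    (hyH : ∀ i ≤ c, y i ∈ H) (h₀ : 2 * c ≤ y 0) : Settled (y 0 / 2) (y 0) (y c) := by
  obtain ⟨i, hi, hs⟩ := hc.exists_settled_gap hH hy hyH h₀
  have hmono {a b : ℕ} (hab : a ≤ b) (hb : b ≤ c) : y a ≤ y b := by
    induction b, hab using Nat.le_induction with
    | base => exact le_rfl
    | succ b _ ih => exact (ih (by omega)).trans (hy b hb).le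
  exact hs.mono le_rfl (hmono (Nat.zero_le i) hi.le) (hmono hi le_rfl)

/-! ### Decoding the `ω`-jump from a thin set -/

/-- The elements `≥ N` of the set with characteristic function given by the list `σ`. -/
def elementsFrom (N : ℕ) (σ : List ℕ) : List ℕ :=
  (List.range σ.length).filter fun i => decide (N ≤ i) && (σ.getD i 0 == 1)

/-- Decides whether `e ∈ ∅^(j)` from an initial segment of an infinite set that avoids the
color `c`, provided that the segment has enough elements. The input is `⟨c, ⟨j, e⟩⟩`. Every
`c + 1`-st element is used as a bound. -/
noncomputable def decodeJump (p : ℕ) (σ : List ℕ) : Option ℕ :=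
  let c := p.unpair.1
  let j := p.unpair.2.unpair.1
  let e := p.unpair.2.unpair.2
  let els := elementsFrom (2 * c + 2 * j + e + 1) σ
  if (c + 1) * j < els.length then
    some (listChar (approxJump ((List.range j).map fun i => els.getD ((c + 1) * (i + 1)) 0)) e)
  else none

theorem charFn_eq_one_iff {X : Set ℕ} {i : ℕ} : charFn X i = 1 ↔ i ∈ X := by
  simp [charFn]

theorem mem_elementsFrom {H : Set ℕ} {N k i : ℕ} :
    i ∈ elementsFrom N ((List.range k).map (charFn H)) ↔ i < k ∧ N ≤ i ∧ i ∈ H := by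
  simp only [elementsFrom, List.length_map, List.length_range, List.mem_filter, List.mem_range,
    Bool.and_eq_true, decide_eq_true_eq, beq_iff_eq]
  refine and_congr_right fun hi => and_congr_right fun _ => ?_
  simp [List.getD, hi, charFn_eq_one_iff]

theorem pairwise_elementsFrom (N : ℕ) (σ : List ℕ) : (elementsFrom N σ).Pairwise (· < ·) :=
  List.pairwise_lt_range.filter _

theorem exists_lt_length_elementsFrom {H : Set ℕ} (hH : H.Infinite) (N n : ℕ) :
    ∃ k, n < (elementsFrom N ((List.range k).map (charFn H))).length := by
  obtain ⟨T, hT, hcard⟩ := (hH.sdiff (Set.finite_Iio N)).exists_subset_card_eq (n + 1)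
  refine ⟨T.sup id + 1, ?_⟩
  have hsub : T ⊆ (elementsFrom N ((List.range (T.sup id + 1)).map (charFn H))).toFinset := by
    intro i hi
    rw [List.mem_toFinset, mem_elementsFrom]
    exact ⟨Nat.lt_succ_of_le (Finset.le_sup (f := id) hi), not_lt.1 (hT hi).2, (hT hi).1⟩
  have := (Finset.card_le_card hsub).trans (List.toFinset_card_le _)
  omega

theorem decodeJump_correct {H : Set ℕ} {c : ℕ} (hH : H.Infinite)
    (hc : ThinForColor unsettledColoring H c) {n k v : ℕ}
    (hv : v ∈ decodeJump (Nat.pair c n) ((List.range k).map (charFn H))) :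
    v = charFn (omegaJump ∅) n := by
  simp only [decodeJump, Nat.unpair_pair] at hv
  set j := n.unpair.1
  set e := n.unpair.2
  set els := elementsFrom (2 * c + 2 * j + e + 1) ((List.range k).map (charFn H)) with hels
  split_ifs at hv with hlen
  · obtain rfl := Option.some.inj hv
    have hgetD (i : ℕ) (hi : i ≤ (c + 1) * j) : els.getD i 0 ∈ els := by
      rw [List.getD_eq_getElem els 0 (hi.trans_lt hlen)]
      exact List.getElem_mem _
    have hlt (i i' : ℕ) (hii : i < i') (hi' : i' ≤ (c + 1) * j) :
        els.getD i 0 < els.getD i' 0 := by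
      rw [List.getD_eq_getElem els 0 (hi'.trans_lt hlen),
        List.getD_eq_getElem els 0 (hii.trans (hi'.trans_lt hlen))]
      exact List.pairwise_iff_getElem.1 (pairwise_elementsFrom _ _) _ _ _ _ hii
    have hge (i : ℕ) (hi : i ≤ (c + 1) * j) : 2 * c + 2 * j + e + 1 ≤ els.getD i 0 :=
      (mem_elementsFrom.1 (hgetD i hi)).2.1
    have hchain := isChain_map_range (R := Settled j) (n := j)
      (g := fun i => els.getD ((c + 1) * i) 0) fun i hi => by
        have hle : (c + 1) * i + (c + 1) ≤ (c + 1) * j := Nat.mul_le_mul_left (c + 1) hi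
        have hge₀ := hge ((c + 1) * i) (by omega)
        refine (hc.settled hH (y := fun t => els.getD ((c + 1) * i + t) 0)
          (fun t ht => hlt _ _ (by omega) (by omega))
          (fun t ht => (mem_elementsFrom.1 (hgetD _ (by omega))).2.2)
          (by simp only [add_zero]; omega)).mono (by simp only [add_zero]; omega) le_rfl
          (hlt _ _ ?_ ?_).le
        · rw [Nat.mul_succ]
          omega
        · exact hle
    rw [List.range_succ_eq_map, List.map_cons, List.map_map] at hchain
    have hmem := mem_approxJump_iff (e := e) hchain (by simp)
      (lt_of_lt_of_le (by omega) (hge _ (by simp)))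
    rw [List.length_map, List.length_range] at hmem
    exact listChar_eq_charFn (X := {m | m ∈ iteratedJump j ∅}) hmem
  · exact absurd hv (by simp)

theorem exists_decodeJump_isSome {H : Set ℕ} (hH : H.Infinite) (p : ℕ) :
    ∃ k, (decodeJump p ((List.range k).map (charFn H))).isSome := by
  obtain ⟨k, hk⟩ := exists_lt_length_elementsFrom hH
    (2 * p.unpair.1 + 2 * p.unpair.2.unpair.1 + p.unpair.2.unpair.2 + 1)
    ((p.unpair.1 + 1) * p.unpair.2.unpair.1)
  exact ⟨k, by simp only [decodeJump, if_pos hk, Option.isSome_some]⟩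

/-! ### Computability of the coloring and of the decoding -/

section Computability

variable {α : Type*} [Primcodable α]

theorem primrec_listChar : Primrec₂ listChar := by
  have h : Primrec fun p : List ℕ × ℕ => if p.1.contains p.2 = true then 1 else 0 :=
    Primrec.ite (Primrec.eq.comp (Primrec.list_contains_nat Primrec.fst Primrec.snd)
      (Primrec.const true)) (Primrec.const 1) (Primrec.const 0)
  exact h

open Nat.Partrec in
theorem primrec_haltsWithin_listChar : Primrec fun p : List ℕ × ℕ × ℕ =>
    OracleCode.haltsWithin (listChar p.1) p.2.1 p.2.2 := by
  have hL : Primrec fun p : List ℕ × ℕ × ℕ => p.1 := Primrec.fst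
  have he : Primrec fun p : List ℕ × ℕ × ℕ => p.2.1 := Primrec.fst.comp Primrec.snd
  have hk : Primrec fun p : List ℕ × ℕ × ℕ => p.2.2.unpair :=
    Primrec.unpair.comp (Primrec.snd.comp Primrec.snd)
  have hσ : Primrec fun p : List ℕ × ℕ × ℕ =>
      (List.range p.2.2.unpair.1).map (listChar p.1) :=
    Primrec.list_map (Primrec.list_range.comp (Primrec.fst.comp hk))
      (primrec_listChar.comp (hL.comp Primrec.fst) Primrec.snd)
  have hd := Code.primrec₂_curry.comp (Primrec.const OracleCode.lookupCode)
    (Primrec.encode.comp hσ)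
  exact Primrec.option_isSome.comp (Code.primrec_evaln.comp (Primrec.pair
    (Primrec.pair (Primrec.snd.comp hk) (OracleCode.primrec_toCode_ofNat.comp hd he)) he))

theorem primrec_boundedJump : Primrec₂ boundedJump := by
  have hr : Primrec fun p : ℕ × List ℕ => List.range p.1 := Primrec.list_range.comp Primrec.fst
  refine Primrec.list_filter_param hr (Primrec.list_any_param (hr.comp Primrec.fst) ?_)
  exact primrec_haltsWithin_listChar.comp (Primrec.pair
    (Primrec.snd.comp (Primrec.fst.comp Primrec.fst))
    (Primrec.pair (Primrec.snd.comp Primrec.fst) Primrec.snd))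

theorem primrec_approxJump : Primrec approxJump :=
  Primrec.list_foldr (h := fun _ p => boundedJump p.1 p.2) Primrec.id (Primrec.const [])
    (primrec_boundedJump.comp (Primrec.fst.comp Primrec.snd) (Primrec.snd.comp Primrec.snd))

theorem primrec_looksUnsettled {zs : α → List ℕ} {x y : α → ℕ} (hzs : Primrec zs)
    (hx : Primrec x) (hy : Primrec y) : Primrec fun a => looksUnsettled (zs a) (x a) (y a) := by
  refine Primrec.list_any_param
    (Primrec.list_range.comp (Primrec.succ.comp (Primrec.list_length.comp hzs))) ?_
  refine Primrec.list_any_param (Primrec.list_range.comp (hx.comp Primrec.fst)) ?_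
  have htake : Primrec fun q : (α × ℕ) × ℕ => (zs q.1.1).take q.1.2 :=
    Primrec.list_take.comp (Primrec.snd.comp Primrec.fst)
      (hzs.comp (Primrec.fst.comp Primrec.fst))
  refine Primrec.and.comp (Primrec.list_contains_nat (primrec_approxJump.comp htake) Primrec.snd)
    (Primrec.not.comp (Primrec.list_contains_nat (primrec_boundedJump.comp
      (hy.comp (Primrec.fst.comp Primrec.fst))
      (primrec_approxJump.comp (Primrec.list_tail.comp htake))) Primrec.snd))

theorem primrec_unsettledCount : Primrec unsettledCount := by
  have hr : Primrec fun l : List ℕ => l.headI - l.headI / 2 :=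
    Primrec.nat_sub.comp Primrec.list_headI
      (Primrec.nat_div.comp Primrec.list_headI (Primrec.const 2))
  have hget {f : List ℕ × ℕ → ℕ} (hf : Primrec f) :
      Primrec fun q : List ℕ × ℕ => q.1.getD (f q) 0 :=
    (Primrec.list_getD 0).comp Primrec.fst hf
  refine Primrec.list_length.comp (Primrec.list_filter_param (Primrec.list_range.comp hr) ?_)
  exact primrec_looksUnsettled
    (Primrec.list_drop.comp (Primrec.succ.comp (hr.comp Primrec.fst)) Primrec.fst)
    (hget Primrec.snd) (hget (Primrec.succ.comp Primrec.snd))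

theorem primrec_elementsFrom : Primrec₂ elementsFrom := by
  refine Primrec.list_filter_param
    (Primrec.list_range.comp (Primrec.list_length.comp Primrec.snd)) ?_
  refine Primrec.and.comp (PrimrecPred.decide (Primrec.nat_le.comp
    (Primrec.fst.comp Primrec.fst) Primrec.snd)) ?_
  exact Primrec.beq.comp ((Primrec.list_getD 0).comp (Primrec.snd.comp Primrec.fst) Primrec.snd)
    (Primrec.const 1)

theorem primrec_decodeJump : Primrec₂ decodeJump := by
  have hu {f : ℕ × List ℕ → ℕ} (hf : Primrec f) : Primrec fun q => (f q).unpair :=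
    Primrec.unpair.comp hf
  have hc : Primrec fun q : ℕ × List ℕ => q.1.unpair.1 := Primrec.fst.comp (hu Primrec.fst)
  have hn : Primrec fun q : ℕ × List ℕ => q.1.unpair.2 := Primrec.snd.comp (hu Primrec.fst)
  have hj : Primrec fun q : ℕ × List ℕ => q.1.unpair.2.unpair.1 := Primrec.fst.comp (hu hn)
  have he : Primrec fun q : ℕ × List ℕ => q.1.unpair.2.unpair.2 := Primrec.snd.comp (hu hn)
  have hels : Primrec fun q : ℕ × List ℕ => elementsFrom
      (2 * q.1.unpair.1 + 2 * q.1.unpair.2.unpair.1 + q.1.unpair.2.unpair.2 + 1) q.2 :=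
    primrec_elementsFrom.comp (Primrec.succ.comp (Primrec.nat_add.comp (Primrec.nat_add.comp
      (Primrec.nat_mul.comp (Primrec.const 2) hc) (Primrec.nat_mul.comp (Primrec.const 2) hj))
      he)) Primrec.snd
  have hc₁ : Primrec fun q : ℕ × List ℕ => q.1.unpair.1 + 1 := Primrec.succ.comp hc
  refine Primrec.ite (Primrec.nat_lt.comp (Primrec.nat_mul.comp hc₁ hj)
    (Primrec.list_length.comp hels)) ?_ (Primrec.const none)
  refine Primrec.option_some.comp (primrec_listChar.comp (primrec_approxJump.comp
    (Primrec.list_map (Primrec.list_range.comp hj) ?_)) he)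
  exact (Primrec.list_getD 0).comp (hels.comp Primrec.fst)
    (Primrec.nat_mul.comp (hc₁.comp Primrec.fst) (Primrec.succ.comp Primrec.snd))

end Computability

theorem mainTheorem1 :
    ∃ f : SchreierBarrier → ℕ, ComputableColoring f ∧
      (∀ H : Set ℕ, H.Infinite → Thin f H → SetTuringReducible (omegaJump ∅) H) ∧
      ∃ Φ : OracleCode, ∀ (H : Set ℕ) (c : ℕ), H.Infinite → ThinForColor f H c →
        ∀ n : ℕ, Φ.eval (charFn H) (Nat.pair c n) = Part.some (charFn (omegaJump ∅) n) := by
  have huniform : ∃ Φ : OracleCode, ∀ (H : Set ℕ) (c : ℕ), H.Infinite →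
      ThinForColor unsettledColoring H c →
        ∀ n : ℕ, Φ.eval (charFn H) (Nat.pair c n) = Part.some (charFn (omegaJump ∅) n) := by
    obtain ⟨Φ, hΦ⟩ := OracleCode.exists_eval_eq_of_prefix (Primrec₂.to_comp primrec_decodeJump)
    exact ⟨Φ, fun H c hH hc n => hΦ _ _ _ (exists_decodeJump_isSome hH _)
      fun k w hw => decodeJump_correct hH hc hw⟩
  refine ⟨unsettledColoring, ⟨unsettledCount, primrec_unsettledCount.to_comp, fun _ => rfl⟩,
    fun H hH hthin => ?_, huniform⟩
  obtain ⟨c, hc⟩ := hthin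
  obtain ⟨Φ, hΦ⟩ := huniform
  -- hard-wire the avoided color into the uniform functional
  obtain ⟨p, hp⟩ := OracleCode.exists_eval_eq_of_computable
    (Primrec₂.natPair.comp (Primrec.const c) Primrec.id).to_comp
  refine (OracleCode.turingReducible_iff_exists_eval _ _).2 ⟨.comp Φ p, funext fun n => ?_⟩
  rw [OracleCode.eval_comp_of_eq_some (hp _ n)]
  exact hΦ H c hH hc n
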